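/- Let $m,n\in\mathbb N_0$, let $\Omega\subset\mathbb R^m$ be a convex compact neighborhood of $0$, and let $\mathcal U=\{u\in L^\infty(\mathbb R,\mathbb R^m): u(t)\in\Omega\text{ for a.a. }t\}$ carry the weak$^*$ topology. For matrices $A_0,\dots,A_m\in\mathbb R^{n\times n}$ and vectors $a_0,\dots,a_m\in\mathbb R^n$ let $\psi(t,x,u)$, $t\in\mathbb R$, be the (Carathéodory) solution with $\psi(0,x,u)=x$ of the affine control system $$\dot x(t)=A_0x(t)+a_0+\sum_{i=1}^m u_i(t)\,[A_ix(t)+a_i],\qquad u\in\mathcal U,$$ and let $\psi^1(t,(x,z),u)$ be the solution, starting in $(x,z)\in\mathbb R^{n}\times\mathbb R$, of the bilinear system $$\frac{d}{dt}\begin{pmatrix}x\\z\end{pmatrix}=\begin{pmatrix}A_0&a_0\\0&0\end{pmatrix}\begin{pmatrix}x\\z\end{pmatrix}+\sum_{i=1}^m u_i(t)\begin{pmatrix}A_i&a_i\\0&0\end{pmatrix}\begin{pmatrix}x\\z\end{pmatrix}.$$ Let $\mathbb Pv$ denote the class of $v\in\mathbb R^{n+1}\setminus\{0\}$ in the projective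 space $\mathbb P^n$. The bilinear system induces the control system on $\mathbb P^n$ with trajectories $\mathbb P\psi^1(t,\mathbb Pv,u)=\mathbb P(\psi^1(t,v,u))$, which leaves $\mathbb P^{n,1}:=\{\mathbb P(x,1): x\in\mathbb R^n\}$ invariant. Let $$\Psi_t(u,x)=(u(t+\cdot),\psi(t,x,u)),\qquad \mathbb P\Psi^1_t(u,p)=(u(t+\cdot),\mathbb P\psi^1(t,p,u))$$ be the control flows on $\mathcal U\times\mathbb R^n$ and on $\mathcal U\times\mathbb P^{n,1}$, respectively. Fix metrics compatible with the topologies of $\mathcal U$, $\mathbb R^n$ and $\mathbb P^{n,1}$, and use the maximum metrics on the products. Definitions. For a flow $\phi$ on a metric space $(X,d)$, a continuous $\varepsilon:X\to(0,\infty)$ and $T>0$, an $(\varepsilon,T)$-chain from $x$ to $y$ consists of $k\ge1$, $x_0=x,x_1,\dots,x_k=y$ in $X$ and $t_0,\dots,t_{k-1}\ge T$ with $d(\phi(t_j,x_j),x_{j+1})<\varepsilon(\phi(t_j,x_j))$ for all $j<k$. A set $Y\subset X$ is strongly chain transitive if for all $x,y\in Y$, all $T>0$ and all continuous $\varepsilon:X\to(0,\infty)$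 there is an $(\varepsilon,T)$-chain from $x$ to $y$; a maximal invariant strongly chain transitive set is an inclusion-maximal element among the nonempty invariant strongly chain transitive sets. For a control system on a metric space $(M,d_M)$ with trajectories $\varphi(t,x,u)$, $x$ is strongly chain controllable to $y$ if for all $T>0$ and all continuous $\varepsilon:M\to(0,\infty)$ there are $k\ge1$, $x_0=x,\dots,x_k=y$ in $M$, $u_0,\dots,u_{k-1}\in\mathcal U$ and $T_0,\dots,T_{k-1}\ge T$ with $d_M(\varphi(T_j,x_j,u_j),x_{j+1})<\varepsilon(\varphi(T_j,x_j,u_j))$ for all $j<k$. A strong chain control set is an inclusion-maximal nonempty set $E^*\subset M$ such that every $x\in E^*$ is strongly chain controllable to every $y\in E^*$ and for every $x\in E^*$ there is $u\in\mathcal U$ with $\varphi(t,x,u)\in E^*$ for all $t\in\mathbb R$. Theorem. Let $\mathbb Ph:\mathbb R^n\to\mathbb P^{n,1}$, $\mathbb Ph(x)=\mathbb P(x,1)$. (i) The map $\mathrm{id}_{\mathcal U}\times\mathbb Ph:\mathcal U\times\mathbb R^n\to\mathcal U\times\mathbb P^{n,1}$ is a topological conjugation of $\Psi$ and $\mathbb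 P\Psi^1$ restricted to $\mathcal U\times\mathbb P^{n,1}$, i.e., it is a homeomorphism and $(\mathrm{id}_{\mathcal U}\times\mathbb Ph)\Psi_t(u,x)=\mathbb P\Psi^1_t(u,\mathbb Ph(x))$ for all $t\in\mathbb R$ and $(u,x)\in\mathcal U\times\mathbb R^n$. (ii) The maximal invariant strongly chain transitive sets of $\mathbb P\Psi^1$ restricted to $\mathcal U\times\mathbb P^{n,1}$ are exactly the images under $\mathrm{id}_{\mathcal U}\times\mathbb Ph$ of the maximal invariant strongly chain transitive sets of $\Psi$. (iii) The strong chain control sets of the system on $\mathbb P^{n,1}$ are exactly the sets $\mathbb Ph(E^*)$, where $E^*$ is a strong chain control set of the affine system on $\mathbb R^n$. -/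

import Mathlib

open MeasureTheory Set Filter Topology
open scoped ENNReal Interval LinearAlgebra.Projectivization

noncomputable section

/-! ### Linear differential equations with bounded measurable coefficients -/

namespace LinearCaratheodory

variable {E : Type*} [NormedAddCommGroup E] [NormedSpace ℝ E]
  {B : ℝ → E →L[ℝ] E} {K : ℝ}

theorem aestronglyMeasurable_apply (hB : AEStronglyMeasurable B volume)
    {g : ℝ → E} (hg : Continuous g) :
    AEStronglyMeasurable (fun s => B s (g s)) volume :=
  (ContinuousLinearMap.id ℝ (E →L[ℝ] E)).aestronglyMeasurable_comp₂ hB hg.aestronglyMeasurable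

theorem intervalIntegrable_apply (hB : AEStronglyMeasurable B volume) (hK : ∀ᵐ s, ‖B s‖ ≤ K)
    {g : ℝ → E} (hg : Continuous g) (a b : ℝ) :
    IntervalIntegrable (fun s => B s (g s)) volume a b := by
  have h1 : IntervalIntegrable (fun s => K * ‖g s‖) volume a b :=
    (continuous_const.mul hg.norm).intervalIntegrable a b
  refine h1.mono_fun' (aestronglyMeasurable_apply hB hg).restrict ?_
  refine ae_restrict_of_ae ?_
  filter_upwards [hK] with s hs
  exact ((B s).le_opNorm _).trans (mul_le_mul_of_nonneg_right hs (norm_nonneg _))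

/-- One Picard step improves a bound of order `k` to a bound of order `k + 1`. -/
theorem norm_integral_le (hB : AEStronglyMeasurable B volume) (hK : ∀ᵐ s, ‖B s‖ ≤ K)
    {g : ℝ → E} (hg : Continuous g) {a C R : ℝ} {k : ℕ}
    (h : ∀ s, |s - a| ≤ R → ‖g s‖ ≤ C * (K * |s - a|) ^ k / k.factorial)
    (t : ℝ) (ht : |t - a| ≤ R) :
    ‖∫ s in a..t, B s (g s)‖ ≤ C * (K * |t - a|) ^ (k + 1) / (k + 1).factorial := by
  have hsub : ∀ s ∈ Ι a t, |s - a| ≤ R := by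
    intro s hs
    refine le_trans ?_ ht
    rcases le_total a t with hat | hat
    · rw [uIoc_of_le hat] at hs
      rw [abs_of_nonneg (by linarith [hs.1]), abs_of_nonneg (by linarith)]
      linarith [hs.2]
    · rw [uIoc_of_ge hat] at hs
      rw [abs_of_nonpos (by linarith [hs.2]), abs_of_nonpos (by linarith)]
      linarith [hs.1]
  have hK0 : 0 ≤ K := by
    obtain ⟨s, hs⟩ := hK.exists
    exact (norm_nonneg _).trans hs
  have hcont : Continuous fun s : ℝ => |s - a| ^ k := by fun_prop
  calc ‖∫ s in a..t, B s (g s)‖ ≤ ∫ s in Ι a t, ‖B s (g s)‖ :=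
        intervalIntegral.norm_integral_le_integral_norm_uIoc
    _ ≤ ∫ s in Ι a t, (C * K ^ (k + 1) / k.factorial) * |s - a| ^ k := by
        refine setIntegral_mono_on_ae ?_ ?_ measurableSet_uIoc ?_
        · exact (intervalIntegrable_iff.1 (intervalIntegrable_apply hB hK hg a t)).norm
        · exact intervalIntegrable_iff.1 ((continuous_const.mul hcont).intervalIntegrable a t)
        · filter_upwards [hK] with s hs hst
          calc ‖B s (g s)‖ ≤ ‖B s‖ * ‖g s‖ := (B s).le_opNorm _
            _ ≤ K * (C * (K * |s - a|) ^ k / k.factorial) :=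
                mul_le_mul hs (h s (hsub s hst)) (norm_nonneg _) hK0
            _ = _ := by rw [mul_pow]; ring
    _ = C * (K * |t - a|) ^ (k + 1) / (k + 1).factorial := by
        rw [integral_const_mul, integral_pow_abs_sub_uIoc, Nat.factorial_succ, mul_pow]
        push_cast
        field_simp

theorem eq_zero_of_integral_eq (hB : AEStronglyMeasurable B volume) (hK : ∀ᵐ s, ‖B s‖ ≤ K)
    {g : ℝ → E} (hg : Continuous g) {a : ℝ} (h : ∀ t, g t = ∫ s in a..t, B s (g s)) (t : ℝ) :
    g t = 0 := by
  obtain ⟨C, hC⟩ := (isCompact_Icc (a := a - |t - a|) (b := a + |t - a|)).exists_bound_of_continuousOn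
    hg.continuousOn
  have key : ∀ k : ℕ, ∀ s, |s - a| ≤ |t - a| → ‖g s‖ ≤ C * (K * |s - a|) ^ k / k.factorial := by
    intro k
    induction k with
    | zero =>
      intro s hs
      have := abs_le.1 hs
      simpa using hC s ⟨by linarith [this.1], by linarith [this.2]⟩
    | succ k ih =>
      intro s hs
      rw [h s]
      exact norm_integral_le hB hK hg ih s hs
  have hlim : Tendsto (fun k : ℕ => C * ((K * |t - a|) ^ k / k.factorial)) atTop (𝓝 (C * 0)) :=
    (FloorSemiring.tendsto_pow_div_factorial_atTop _).const_mul C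
  have : ‖g t‖ ≤ C * 0 := ge_of_tendsto' hlim fun k => by
    simpa [mul_div_assoc] using key k t le_rfl
  simpa using this

theorem exists_integral_eq [CompleteSpace E]
    (hB : AEStronglyMeasurable B volume) (hK : ∀ᵐ s, ‖B s‖ ≤ K)
    {g₀ : ℝ → E} (hg₀ : Continuous g₀) (a : ℝ) :
    ∃ g : ℝ → E, Continuous g ∧ ∀ t, g t = g₀ t + ∫ s in a..t, B s (g s) := by
  let G : ℕ → ℝ → E := fun k => Nat.rec g₀ (fun _ f t => ∫ s in a..t, B s (f s)) k
  have hG0 : G 0 = g₀ := rfl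
  have hGs : ∀ k t, G (k + 1) t = ∫ s in a..t, B s (G k s) := fun k t => rfl
  have hGc : ∀ k, Continuous (G k) := by
    intro k
    induction k with
    | zero => exact hg₀
    | succ k ih =>
      exact intervalIntegral.continuous_primitive (intervalIntegrable_apply hB hK ih) a
  have hK0 : 0 ≤ K := by
    obtain ⟨s, hs⟩ := hK.exists
    exact (norm_nonneg _).trans hs
  have hbd : ∀ R : ℝ, ∃ C : ℝ, 0 ≤ C ∧ ∀ k s, |s - a| ≤ R →
      ‖G k s‖ ≤ C * ((K * R) ^ k / k.factorial) := by
    intro R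
    obtain ⟨C, hC⟩ := (isCompact_Icc (a := a - R) (b := a + R)).exists_bound_of_continuousOn
      hg₀.continuousOn
    have hC' : ∀ s, |s - a| ≤ R → ‖g₀ s‖ ≤ |C| := fun s hs => by
      have := abs_le.1 hs
      exact (hC s ⟨by linarith [this.1], by linarith [this.2]⟩).trans (le_abs_self C)
    have key : ∀ k : ℕ, ∀ s, |s - a| ≤ R → ‖G k s‖ ≤ |C| * (K * |s - a|) ^ k / k.factorial := by
      intro k
      induction k with
      | zero => intro s hs; simpa [hG0] using hC' s hs
      | succ k ih => intro s hs; rw [hGs]; exact norm_integral_le hB hK (hGc k) ih s hs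
    refine ⟨|C|, abs_nonneg C, fun k s hs => (key k s hs).trans ?_⟩
    rw [mul_div_assoc]
    gcongr
  have hsum : ∀ R : ℝ, ∀ C : ℝ, Summable fun k : ℕ => C * ((K * R) ^ k / k.factorial) :=
    fun R C => (Real.summable_pow_div_factorial _).mul_left C
  have hGsum : ∀ t, Summable fun k => G k t := fun t => by
    obtain ⟨C, -, hC⟩ := hbd |t - a|
    exact Summable.of_norm_bounded (hsum _ C) fun k => hC k t le_rfl
  let g : ℝ → E := fun t => ∑' k, G k t
  have hgc : Continuous g := by
    rw [continuous_iff_continuousAt]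
    intro t
    obtain ⟨C, -, hC⟩ := hbd (|t - a| + 1)
    have hon : ContinuousOn g {s | |s - a| ≤ |t - a| + 1} :=
      continuousOn_tsum (fun k => (hGc k).continuousOn) (hsum _ C) fun k s hs => hC k s hs
    refine hon.continuousAt ?_
    have hopen : IsOpen {s : ℝ | |s - a| < |t - a| + 1} :=
      isOpen_lt (by fun_prop) continuous_const
    exact mem_of_superset (hopen.mem_nhds (by simp)) fun s hs => by
      simp only [mem_ofPred_eq] at hs ⊢
      exact hs.le
  refine ⟨g, hgc, fun t => ?_⟩
  obtain ⟨C, hC0, hC⟩ := hbd |t - a|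
  have hsub : ∀ s ∈ Ι a t, |s - a| ≤ |t - a| := by
    intro s hs
    rcases le_total a t with hat | hat
    · rw [uIoc_of_le hat] at hs
      rw [abs_of_nonneg (by linarith [hs.1]), abs_of_nonneg (by linarith)]
      linarith [hs.2]
    · rw [uIoc_of_ge hat] at hs
      rw [abs_of_nonpos (by linarith [hs.2]), abs_of_nonpos (by linarith)]
      linarith [hs.1]
  have hint : HasSum (fun k => ∫ s in a..t, B s (G k s)) (∫ s in a..t, B s (g s)) := by
    refine intervalIntegral.hasSum_integral_of_dominated_convergence
      (fun k _ => K * (C * ((K * |t - a|) ^ k / k.factorial))) ?_ ?_ ?_ ?_ ?_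
    · exact fun k => (aestronglyMeasurable_apply hB (hGc k)).restrict
    · intro k
      filter_upwards [hK] with s hs hst
      exact ((B s).le_opNorm _).trans (mul_le_mul hs (hC k s (hsub s hst)) (norm_nonneg _) hK0)
    · exact Eventually.of_forall fun s _ => (hsum _ C).mul_left K
    · exact intervalIntegrable_const
    · exact Eventually.of_forall fun s _ => (hGsum s).hasSum.mapL (B s)
  have h1 : g t = G 0 t + ∑' k, G (k + 1) t := (hGsum t).tsum_eq_zero_add
  rw [h1, hG0]
  congr 1
  exact hint.tsum_eq

end LinearCaratheodory

/-! ### Control functions -/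

namespace AffineControl

/-- The set `𝒰` of admissible controls: (classes of) functions `u ∈ L^∞(ℝ, ℝ^m)` with
`u(t) ∈ Ω` for almost all `t ∈ ℝ`. -/
structure Control {m : ℕ} (Ω : Set (EuclideanSpace ℝ (Fin m))) where
  /-- the underlying element of `L^∞(ℝ, ℝ^m)` -/
  toLp : Lp (EuclideanSpace ℝ (Fin m)) ∞ (volume : Measure ℝ)
  ae_mem : ∀ᵐ t, toLp t ∈ Ω

variable {m : ℕ} {Ω : Set (EuclideanSpace ℝ (Fin m))}

/-- The weak* topology of `L^∞(ℝ, ℝ^m) = L^1(ℝ, ℝ^m)'` on `𝒰`: the coarsest topology that makes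
`u ↦ ∫ ⟨u(t), y(t)⟩ dt` continuous for every `y ∈ L^1(ℝ, ℝ^m)`. -/
instance : TopologicalSpace (Control Ω) :=
  TopologicalSpace.induced
    (fun u (y : Lp (EuclideanSpace ℝ (Fin m)) 1 (volume : Measure ℝ)) =>
      ∫ t, inner ℝ (u.toLp t) (y t))
    Pi.topologicalSpace

/-- The shifted control `u(t + ·)`. -/
def Control.shift (t : ℝ) (u : Control Ω) : Control Ω where
  toLp := Lp.compMeasurePreserving (fun s => t + s) (measurePreserving_add_left volume t) u.toLp
  ae_mem := by
    have h := (measurePreserving_add_left (volume : Measure ℝ) t).quasiMeasurePreserving.ae u.ae_mem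
    filter_upwards [h, Lp.coeFn_compMeasurePreserving u.toLp
      (measurePreserving_add_left (volume : Measure ℝ) t)] with s hs hs'
    rw [hs']
    exact hs

/-! ### Affine control systems and their trajectories -/

/-- The data of an affine control system
`x'(t) = A₀ x(t) + a₀ + ∑ i, u_i(t) (A_i x(t) + a_i)` on `E` with `m` scalar controls. -/
structure AffineSystem (m : ℕ) (E : Type*) [NormedAddCommGroup E] [NormedSpace ℝ E] where
  A₀ : E →L[ℝ] E
  a₀ : E
  A : Fin m → E →L[ℝ] E
  a : Fin m → E

/-- The affine control system on `ℝ^n` with coefficient matrices `A₀, A_i` and vectors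
`a₀, a_i`. -/
def ofMatrices {m n : ℕ} (A₀ : Matrix (Fin n) (Fin n) ℝ) (a₀ : EuclideanSpace ℝ (Fin n))
    (A : Fin m → Matrix (Fin n) (Fin n) ℝ) (a : Fin m → EuclideanSpace ℝ (Fin n)) :
    AffineSystem m (EuclideanSpace ℝ (Fin n)) where
  A₀ := Matrix.toEuclideanCLM (𝕜 := ℝ) A₀
  a₀ := a₀
  A i := Matrix.toEuclideanCLM (𝕜 := ℝ) (A i)
  a := a

namespace AffineSystem

variable {E : Type*} [NormedAddCommGroup E] [NormedSpace ℝ E] (S : AffineSystem m E)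

/-- The right-hand side `A₀ x + a₀ + ∑ i, w_i (A_i x + a_i)` for the control value `w ∈ ℝ^m`. -/
def rhs (w : EuclideanSpace ℝ (Fin m)) (x : E) : E :=
  S.A₀ x + S.a₀ + ∑ i, w i • (S.A i x + S.a i)

/-- `γ` is a (Carathéodory) solution on `ℝ` for the control `u`, with `γ(0) = x`. -/
structure IsSolution (u : Control Ω) (x : E) (γ : ℝ → E) : Prop where
  continuous : Continuous γ
  intervalIntegrable : ∀ t, IntervalIntegrable (fun s => S.rhs (u.toLp s) (γ s)) volume 0 t
  eq_integral : ∀ t, γ t = x + ∫ s in (0 : ℝ)..t, S.rhs (u.toLp s) (γ s)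

/-- the linear part of the right-hand side along a control -/
def coeff (u : Control Ω) (s : ℝ) : E →L[ℝ] E := S.A₀ + ∑ i, (u.toLp s) i • S.A i

/-- the constant part of the right-hand side along a control -/
def inhom (u : Control Ω) (s : ℝ) : E := S.a₀ + ∑ i, (u.toLp s) i • S.a i

theorem rhs_eq (u : Control Ω) (s : ℝ) (x : E) :
    S.rhs (u.toLp s) x = S.coeff u s x + S.inhom u s := by
  simp only [rhs, coeff, inhom, smul_add, Finset.sum_add_distrib, add_apply,
    sum_apply, smul_apply]
  abel

theorem ae_norm_le (u : Control Ω) : ∀ᵐ s, ‖u.toLp s‖ ≤ ‖u.toLp‖ := by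
  have h := ae_le_eLpNormEssSup (f := u.toLp) (μ := (volume : Measure ℝ))
  have hfin := Lp.eLpNorm_ne_top u.toLp
  rw [eLpNorm_exponent_top] at hfin
  filter_upwards [h] with s hs
  rw [Lp.norm_def, eLpNorm_exponent_top, ← toReal_enorm]
  exact ENNReal.toReal_mono hfin hs

theorem aestronglyMeasurable_coord (u : Control Ω) (i : Fin m) :
    AEStronglyMeasurable (fun s => (u.toLp s) i) volume :=
  (EuclideanSpace.proj (𝕜 := ℝ) i).continuous.comp_aestronglyMeasurable
    (Lp.aestronglyMeasurable u.toLp)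

theorem ae_coord_le (u : Control Ω) : ∀ᵐ s, ∀ i, |(u.toLp s) i| ≤ ‖u.toLp‖ := by
  filter_upwards [ae_norm_le u] with s hs i
  exact (PiLp.norm_apply_le (u.toLp s) i).trans hs

theorem aestronglyMeasurable_coeff (u : Control Ω) :
    AEStronglyMeasurable (S.coeff u) volume := by
  unfold coeff
  refine aestronglyMeasurable_const.add ?_
  exact Finset.aestronglyMeasurable_fun_sum _ fun i _ =>
    (aestronglyMeasurable_coord u i).smul_const _

theorem ae_norm_coeff_le (u : Control Ω) :
    ∀ᵐ s, ‖S.coeff u s‖ ≤ ‖S.A₀‖ + ∑ i, ‖u.toLp‖ * ‖S.A i‖ := by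
  filter_upwards [ae_coord_le u] with s hs
  refine (norm_add_le _ _).trans (add_le_add le_rfl ((norm_sum_le _ _).trans ?_))
  refine Finset.sum_le_sum fun i _ => ?_
  rw [norm_smul]
  exact mul_le_mul_of_nonneg_right (hs i) (norm_nonneg _)

theorem intervalIntegrable_inhom (u : Control Ω) (p q : ℝ) :
    IntervalIntegrable (S.inhom u) volume p q := by
  have hm : AEStronglyMeasurable (S.inhom u) volume := by
    unfold inhom
    refine aestronglyMeasurable_const.add ?_
    exact Finset.aestronglyMeasurable_fun_sum _ fun i _ =>
      (aestronglyMeasurable_coord u i).smul_const _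
  have hc : IntervalIntegrable (fun _ : ℝ => ‖S.a₀‖ + ∑ i, ‖u.toLp‖ * ‖S.a i‖) volume p q :=
    intervalIntegrable_const
  refine hc.mono_fun' hm.restrict (ae_restrict_of_ae ?_)
  filter_upwards [ae_coord_le u] with s hs
  refine (norm_add_le _ _).trans (add_le_add le_rfl ((norm_sum_le _ _).trans ?_))
  refine Finset.sum_le_sum fun i _ => ?_
  rw [norm_smul]
  exact mul_le_mul_of_nonneg_right (hs i) (norm_nonneg _)

theorem integral_rhs (u : Control Ω) {γ : ℝ → E} (hγ : Continuous γ) (p q : ℝ) :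
    ∫ s in p..q, S.rhs (u.toLp s) (γ s) =
      (∫ s in p..q, S.coeff u s (γ s)) + ∫ s in p..q, S.inhom u s := by
  simp_rw [rhs_eq]
  exact intervalIntegral.integral_add (LinearCaratheodory.intervalIntegrable_apply
    (S.aestronglyMeasurable_coeff u) (S.ae_norm_coeff_le u) hγ p q)
    (S.intervalIntegrable_inhom u p q)

theorem intervalIntegrable_rhs (u : Control Ω) {γ : ℝ → E} (hγ : Continuous γ) (p q : ℝ) :
    IntervalIntegrable (fun s => S.rhs (u.toLp s) (γ s)) volume p q := by
  simp_rw [rhs_eq]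
  exact (LinearCaratheodory.intervalIntegrable_apply
    (S.aestronglyMeasurable_coeff u) (S.ae_norm_coeff_le u) hγ p q).add
    (S.intervalIntegrable_inhom u p q)

/-- Two solutions for the same control that meet at some time coincide. -/
theorem IsSolution.eq_of_meet {S : AffineSystem m E} {u : Control Ω} {x y : E} {γ δ : ℝ → E}
    (hγ : S.IsSolution u x γ) (hδ : S.IsSolution u y δ) {t₀ : ℝ} (h : γ t₀ = δ t₀) : γ = δ := by
  have hc : Continuous fun t => γ t - δ t := hγ.continuous.sub hδ.continuous
  have key := LinearCaratheodory.eq_zero_of_integral_eq (S.aestronglyMeasurable_coeff u)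
    (S.ae_norm_coeff_le u) hc (a := t₀) ?_
  · funext t
    exact sub_eq_zero.1 (key t)
  intro t
  have h1 : γ t - γ t₀ = ∫ s in t₀..t, S.rhs (u.toLp s) (γ s) := by
    rw [hγ.eq_integral t, hγ.eq_integral t₀, add_sub_add_left_eq_sub]
    exact intervalIntegral.integral_interval_sub_left (hγ.intervalIntegrable t)
      (hγ.intervalIntegrable t₀)
  have h2 : δ t - δ t₀ = ∫ s in t₀..t, S.rhs (u.toLp s) (δ s) := by
    rw [hδ.eq_integral t, hδ.eq_integral t₀, add_sub_add_left_eq_sub]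
    exact intervalIntegral.integral_interval_sub_left (hδ.intervalIntegrable t)
      (hδ.intervalIntegrable t₀)
  have hi : ∀ {g : ℝ → E}, Continuous g → ∀ p q : ℝ,
      IntervalIntegrable (fun s => S.coeff u s (g s)) volume p q := fun hg =>
    LinearCaratheodory.intervalIntegrable_apply
      (S.aestronglyMeasurable_coeff u) (S.ae_norm_coeff_le u) hg
  simp_rw [map_sub]
  rw [intervalIntegral.integral_sub (hi hγ.continuous t₀ t) (hi hδ.continuous t₀ t)]
  rw [S.integral_rhs u hγ.continuous] at h1
  rw [S.integral_rhs u hδ.continuous] at h2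
  have : γ t - δ t = (γ t - γ t₀) - (δ t - δ t₀) := by rw [h]; abel
  rw [this, h1, h2]
  abel

theorem exists_isSolution [CompleteSpace E] (u : Control Ω) (x : E) :
    ∃ γ, S.IsSolution u x γ := by
  obtain ⟨γ, hc, hγ⟩ := LinearCaratheodory.exists_integral_eq (S.aestronglyMeasurable_coeff u)
    (S.ae_norm_coeff_le u) (g₀ := fun t => x + ∫ s in (0 : ℝ)..t, S.inhom u s)
    (continuous_const.add
      (intervalIntegral.continuous_primitive (S.intervalIntegrable_inhom u) 0)) 0
  refine ⟨γ, hc, S.intervalIntegrable_rhs u hc 0, fun t => ?_⟩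
  rw [S.integral_rhs u hc, hγ t]
  abel

section Complete

variable [CompleteSpace E]

/-- The solution `ψ(t, x, u)` with `ψ(0, x, u) = x`; see `isSolution_trajectory` and
`IsSolution.eq_trajectory` for existence and uniqueness. -/
def trajectory (t : ℝ) (x : E) (u : Control Ω) : E := (S.exists_isSolution u x).choose t

theorem isSolution_trajectory (u : Control Ω) (x : E) :
    S.IsSolution u x (fun t => S.trajectory t x u) :=
  (S.exists_isSolution u x).choose_spec

theorem IsSolution.eq_trajectory {S : AffineSystem m E} {u : Control Ω} {x : E} {γ : ℝ → E}
    (hγ : S.IsSolution u x γ) : γ = fun t => S.trajectory t x u := by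
  have hδ := S.isSolution_trajectory u x
  refine hγ.eq_of_meet hδ (t₀ := 0) ?_
  rw [hγ.eq_integral, hδ.eq_integral]
  simp

end Complete

/-! ### The extended bilinear system and the induced system on projective space -/

/-- The bilinear system on `E × ℝ` with the coefficients `(x, z) ↦ (A_i x + z a_i, 0)`, i.e. with
the block matrices with rows `(A_i, a_i)` and `(0, 0)`, `i = 0, …, m`. -/
def lift (S : AffineSystem m E) : AffineSystem m (E × ℝ) where
  A₀ := (S.A₀.comp (ContinuousLinearMap.fst ℝ E ℝ) +
    (ContinuousLinearMap.snd ℝ E ℝ).smulRight S.a₀).prod 0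
  a₀ := 0
  A i := ((S.A i).comp (ContinuousLinearMap.fst ℝ E ℝ) +
    (ContinuousLinearMap.snd ℝ E ℝ).smulRight (S.a i)).prod 0
  a _ := 0

theorem lift_rhs (w : EuclideanSpace ℝ (Fin m)) (x : E) (z : ℝ) :
    S.lift.rhs w (x, z) =
      (S.A₀ x + z • S.a₀ + ∑ i, w i • (S.A i x + z • S.a i), 0) := by
  ext <;> simp [rhs, lift, Prod.fst_sum, Prod.snd_sum]

theorem lift_rhs_add (w : EuclideanSpace ℝ (Fin m)) (v v' : E × ℝ) :
    S.lift.rhs w (v + v') = S.lift.rhs w v + S.lift.rhs w v' := by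
  simp only [rhs, map_add, smul_add, Finset.sum_add_distrib, lift, add_zero]
  abel

theorem lift_rhs_smul (w : EuclideanSpace ℝ (Fin m)) (c : ℝ) (v : E × ℝ) :
    S.lift.rhs w (c • v) = c • S.lift.rhs w v := by
  simp only [rhs, map_smul, lift, add_zero, smul_add, Finset.smul_sum]
  simp only [smul_comm c]

variable [CompleteSpace E]

theorem lift_trajectory_add (t : ℝ) (v v' : E × ℝ) (u : Control Ω) :
    S.lift.trajectory t (v + v') u = S.lift.trajectory t v u + S.lift.trajectory t v' u := by
  have h := S.lift.isSolution_trajectory u v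
  have h' := S.lift.isSolution_trajectory u v'
  have hs : S.lift.IsSolution u (v + v')
      (fun t => S.lift.trajectory t v u + S.lift.trajectory t v' u) := by
    refine ⟨h.continuous.add h'.continuous, fun t => ?_, fun t => ?_⟩
    · simp_rw [lift_rhs_add]
      exact (h.intervalIntegrable t).add (h'.intervalIntegrable t)
    · simp_rw [lift_rhs_add]
      rw [intervalIntegral.integral_add (h.intervalIntegrable t) (h'.intervalIntegrable t)]
      rw [add_add_add_comm]
      exact congrArg₂ _ (h.eq_integral t) (h'.eq_integral t)
  exact (congrFun hs.eq_trajectory t).symm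

theorem lift_trajectory_smul (t c : ℝ) (v : E × ℝ) (u : Control Ω) :
    S.lift.trajectory t (c • v) u = c • S.lift.trajectory t v u := by
  have h := S.lift.isSolution_trajectory u v
  have hs : S.lift.IsSolution u (c • v) (fun t => c • S.lift.trajectory t v u) := by
    refine ⟨h.continuous.const_smul c, fun t => ?_, fun t => ?_⟩
    · simp_rw [lift_rhs_smul]
      exact (h.intervalIntegrable t).smul c
    · simp_rw [lift_rhs_smul]
      rw [intervalIntegral.integral_smul, ← smul_add]
      exact congrArg _ (h.eq_integral t)
  exact (congrFun hs.eq_trajectory t).symm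

/-- The linear map `v ↦ ψ¹(t, v, u)` on `E × ℝ`. -/
def liftLinear (t : ℝ) (u : Control Ω) : E × ℝ →ₗ[ℝ] E × ℝ where
  toFun v := S.lift.trajectory t v u
  map_add' v v' := S.lift_trajectory_add t v v' u
  map_smul' c v := S.lift_trajectory_smul t c v u

theorem liftLinear_injective (t : ℝ) (u : Control Ω) :
    Function.Injective (S.liftLinear t u) := by
  intro v v' hvv
  have h := S.lift.isSolution_trajectory u v
  have h' := S.lift.isSolution_trajectory u v'
  have e : (fun t => S.lift.trajectory t v u) = fun t => S.lift.trajectory t v' u :=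
    h.eq_of_meet h' hvv
  have e0 : S.lift.trajectory 0 v u = S.lift.trajectory 0 v' u := congrFun e 0
  have a := h.eq_integral 0
  have a' := h'.eq_integral 0
  simp only [intervalIntegral.integral_same, add_zero] at a a'
  rw [← a, ← a', e0]

/-- The last coordinate of the extended bilinear system is constant along trajectories. -/
theorem lift_trajectory_snd (t : ℝ) (v : E × ℝ) (u : Control Ω) :
    (S.lift.trajectory t v u).2 = v.2 := by
  have h := S.lift.isSolution_trajectory u v
  have e := congrArg (ContinuousLinearMap.snd ℝ E ℝ) (h.eq_integral t)
  rw [map_add, ← ContinuousLinearMap.intervalIntegral_comp_comm _ (h.intervalIntegrable t)] at e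
  have hz : ∀ s, (ContinuousLinearMap.snd ℝ E ℝ)
      (S.lift.rhs (u.toLp s) (S.lift.trajectory s v u)) = 0 := fun s => by
    rw [← Prod.mk.eta (p := S.lift.trajectory s v u), lift_rhs]
    rfl
  simp only [hz, intervalIntegral.integral_zero, add_zero] at e
  exact e

/-- The trajectories `ℙψ¹(t, ℙv, u) = ℙ(ψ¹(t, v, u))` of the control system induced on the
projective space of `E × ℝ`. -/
def projTrajectory (t : ℝ) (p : ℙ ℝ (E × ℝ)) (u : Control Ω) : ℙ ℝ (E × ℝ) :=
  Projectivization.map (S.liftLinear t u) (S.liftLinear_injective t u) p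

end AffineSystem

/-- Projective space carries the quotient topology of `V \ {0}`. -/
instance projectivizationTopology (V : Type*) [AddCommGroup V] [Module ℝ V] [TopologicalSpace V] :
    TopologicalSpace (ℙ ℝ V) :=
  TopologicalSpace.coinduced (Projectivization.mk' ℝ) inferInstance

section AffinePart

variable {E : Type*} [NormedAddCommGroup E] [NormedSpace ℝ E]

variable (E) in
/-- The set `ℙ^{n,1} = {ℙ(x, 1) | x ∈ E}` (for `E = ℝ^n`) with the subspace topology. -/
abbrev ProjAffine : Type _ :=
  {p : ℙ ℝ (E × ℝ) // ∃ x : E, p = Projectivization.mk ℝ (x, (1 : ℝ)) (by simp)}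

/-- The map `ℙh : x ↦ ℙ(x, 1)`. -/
def projEmb (x : E) : ProjAffine E := ⟨Projectivization.mk ℝ (x, (1 : ℝ)) (by simp), x, rfl⟩

/-- The restriction of the induced system to the invariant set `ℙ^{n,1}`. -/
def AffineSystem.projTrajectoryAffine [CompleteSpace E] (S : AffineSystem m E) (t : ℝ)
    (p : ProjAffine E) (u : Control Ω) : ProjAffine E :=
  ⟨S.projTrajectory t p.1 u, by
    obtain ⟨_, x, rfl⟩ := p
    refine ⟨(S.lift.trajectory t (x, 1) u).1, ?_⟩
    have h := S.lift_trajectory_snd t (x, 1) u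
    simp only [projTrajectory, Projectivization.map_mk]
    congr 1
    exact Prod.ext rfl h⟩

end AffinePart

/-- The control flow `(t, (u, x)) ↦ (u(t + ·), φ(t, x, u))` on `𝒰 × M` of a control system on `M`
with trajectories `φ(t, x, u)`. -/
def controlFlow {M : Type*} (φ : ℝ → M → Control Ω → M) (t : ℝ) (p : Control Ω × M) :
    Control Ω × M :=
  (p.1.shift t, φ t p.2 p.1)

end AffineControl

/-! ### Strong chain transitivity and strong chain control sets -/

namespace StrongChain

/-- `d` is a metric on `X` that induces the given topology of `X`. -/
def IsCompatibleMetric {X : Type*} [τ : TopologicalSpace X] (d : X → X → ℝ) : Prop :=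
  ∃ inst : MetricSpace X,
    inst.toPseudoMetricSpace.toUniformSpace.toTopologicalSpace = τ ∧
      ∀ x y, d x y = inst.toPseudoMetricSpace.dist x y

/-- The maximum metric on a product. -/
def maxMetric {X Y : Type*} (d : X → X → ℝ) (d' : Y → Y → ℝ) (p q : X × Y) : ℝ :=
  max (d p.1 q.1) (d' p.2 q.2)

section Flow

variable {X Y : Type*} [TopologicalSpace X] [TopologicalSpace Y]

/-- `h` is a homeomorphism that conjugates the flows `φ` and `ψ`. -/
def IsTopologicalConjugation (φ : ℝ → X → X) (ψ : ℝ → Y → Y) (h : X → Y) : Prop :=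
  IsHomeomorph h ∧ ∀ t x, h (φ t x) = ψ t (h x)

/-- There is an `(ε, T)`-chain from `x` to `y` for the jump function `ε`. -/
def HasChain (d : X → X → ℝ) (φ : ℝ → X → X) (ε : X → ℝ) (T : ℝ) (x y : X) : Prop :=
  ∃ (k : ℕ) (c : ℕ → X) (τ : ℕ → ℝ), 1 ≤ k ∧ c 0 = x ∧ c k = y ∧
    ∀ j < k, T ≤ τ j ∧ d (φ (τ j) (c j)) (c (j + 1)) < ε (φ (τ j) (c j))

/-- `A` is strongly chain transitive. -/
def IsStronglyChainTransitive (d : X → X → ℝ) (φ : ℝ → X → X) (A : Set X) : Prop :=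
  ∀ x ∈ A, ∀ y ∈ A, ∀ T : ℝ, 0 < T → ∀ ε : X → ℝ, Continuous ε → (∀ z, 0 < ε z) →
    HasChain d φ ε T x y

/-- `A` is a maximal invariant strongly chain transitive set: it is maximal with respect to
inclusion among the nonempty invariant strongly chain transitive sets. -/
def IsMaximalInvariantSCT (d : X → X → ℝ) (φ : ℝ → X → X) (A : Set X) : Prop :=
  Maximal (fun B : Set X => B.Nonempty ∧ (∀ t, ∀ x ∈ B, φ t x ∈ B) ∧
    IsStronglyChainTransitive d φ B) A

end Flow

section ControlSystem

variable {M U : Type*} [TopologicalSpace M]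

/-- There is a controlled `(ε, T)`-chain from `x` to `y` for the system with trajectories
`φ(t, x, u)`, `u ∈ U`. -/
def HasControlledChain (d : M → M → ℝ) (φ : ℝ → M → U → M) (ε : M → ℝ) (T : ℝ) (x y : M) : Prop :=
  ∃ (k : ℕ) (c : ℕ → M) (u : ℕ → U) (τ : ℕ → ℝ), 1 ≤ k ∧ c 0 = x ∧ c k = y ∧
    ∀ j < k, T ≤ τ j ∧ d (φ (τ j) (c j) (u j)) (c (j + 1)) < ε (φ (τ j) (c j) (u j))

/-- `x` is strongly chain controllable to `y`. -/
def IsStronglyChainControllable (d : M → M → ℝ) (φ : ℝ → M → U → M) (x y : M) : Prop :=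
  ∀ T : ℝ, 0 < T → ∀ ε : M → ℝ, Continuous ε → (∀ z, 0 < ε z) → HasControlledChain d φ ε T x y

/-- `F` is a strong chain control set: a maximal nonempty set such that every point of `F` is
strongly chain controllable to every point of `F`, and for every `x ∈ F` some control keeps the
trajectory from `x` in `F` for all times `t ∈ ℝ`. -/
def IsStrongChainControlSet (d : M → M → ℝ) (φ : ℝ → M → U → M) (F : Set M) : Prop :=
  Maximal (fun G : Set M => G.Nonempty ∧
    (∀ x ∈ G, ∀ y ∈ G, IsStronglyChainControllable d φ x y) ∧
    (∀ x ∈ G, ∃ u : U, ∀ t : ℝ, φ t x u ∈ G)) F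

end ControlSystem

end StrongChain

end

open AffineControl StrongChain

/-! ### Transfer along homeomorphisms -/

namespace StrongChain

section Transfer

variable {X Y : Type*} [TopologicalSpace X] [TopologicalSpace Y]

/-! On the hyperplane `z = 1` the bilinear system is the affine one: its last coordinate is
constant, and `(ψ(t,x,u), 1)` solves it, so uniqueness gives `lift_trajectory_one`. The chart `x ↦
ℙ(x,1)` is a homeomorphism onto its image (`isHomeomorph_projEmb`), with inverse `ℙ(x,z) ↦ z⁻¹x`.
Together these give the conjugacy (i).

The chart need not be uniformly continuous, so chains with constant `ε` need not transfer along it.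
Strong chains do, because their jump sizes are arbitrary positive continuous functions. Given such
an `ε` on the target, `exists_jump_pullback` glues local moduli of continuity into a continuous
positive `δ` on the source, so that `δ`-jumps map to `ε`-jumps. Strong chain notions therefore
depend only on the topology, and a homeomorphic conjugacy carries them over in both directions.
Maximality follows because direct image is an order isomorphism of power sets. This yields (ii) and
(iii). -/

theorem IsCompatibleMetric.maxMetric {d : X → X → ℝ} {d' : Y → Y → ℝ}
    (hd : IsCompatibleMetric d) (hd' : IsCompatibleMetric d') :
    IsCompatibleMetric (maxMetric d d') := by
  -- Substituting the topology by the one from the metric makes the compatibility of the product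
  -- metric definitional: the standard product distance is the maximum.
  obtain ⟨i, rfl, h⟩ := hd
  obtain ⟨i', rfl, h'⟩ := hd'
  exact ⟨inferInstance, rfl, fun p q => by simp only [StrongChain.maxMetric, h, h']; rfl⟩

/-- Along a homeomorphism, every jump function on the target dominates the image of a jump
function on the source. -/
theorem exists_jump_pullback {d : X → X → ℝ} {d' : Y → Y → ℝ} (hd : IsCompatibleMetric d)
    (hd' : IsCompatibleMetric d') (h : X ≃ₜ Y) {ε : Y → ℝ} (hε : Continuous ε)
    (hpos : ∀ y, 0 < ε y) :
    ∃ δ : X → ℝ, Continuous δ ∧ (∀ x, 0 < δ x) ∧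
      ∀ x y, d x y < δ x → d' (h x) (h y) < ε (h x) := by
  obtain ⟨i, rfl, e⟩ := hd
  obtain ⟨i', rfl, e'⟩ := hd'
  -- Shrinking an admissible radius keeps it admissible, so the admissible radii at `x` form an
  -- interval. Convexity lets a partition of unity average local choices.
  have hconv : ∀ x : X, Convex ℝ {r : ℝ | 0 < r ∧ ∀ y, dist x y < r →
      dist (h x) (h y) < ε (h x)} := by
    intro x
    refine Set.OrdConnected.convex ⟨?_⟩
    rintro p ⟨hp, -⟩ q ⟨-, hq⟩ r ⟨hpr, hrq⟩
    exact ⟨hp.trans_le hpr, fun y hy => hq y (hy.trans_le hrq)⟩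
  -- It suffices to find, near each `x`, one constant radius admissible at all nearby `z`. Here `r /
  -- 2` works: `y` and `z` both lie within `r` of `x`, so their images are less than `2 · ε (h x) /
  -- 4 < ε (h z)` apart.
  obtain ⟨g, hg⟩ := exists_continuous_forall_mem_convex_of_local_const hconv (fun x => by
    have hx := hpos (h x)
    obtain ⟨r, hr, hball⟩ := Metric.continuousAt_iff.1 h.continuous.continuousAt (ε (h x) / 4)
      (by positivity : 0 < ε (h x) / 4)
    have hlow : ∀ᶠ z in 𝓝 x, ε (h x) / 2 < ε (h z) :=
      (hε.comp h.continuous).continuousAt.eventually (lt_mem_nhds (half_lt_self hx))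
    refine ⟨r / 2, ?_⟩
    filter_upwards [hlow, Metric.ball_mem_nhds x (half_pos hr)] with z hz hzx
    rw [Metric.mem_ball] at hzx
    refine ⟨half_pos hr, fun y hy => ?_⟩
    have h1 := hball (show dist z x < r by linarith)
    have h2 := hball (show dist y x < r by
      have := dist_triangle_left y x z
      linarith)
    have h3 := dist_triangle_right (h z) (h y) (h x)
    linarith)
  exact ⟨g, g.continuous, fun x => (hg x).1, fun x y hxy => by
    rw [e']
    exact (hg x).2 y (by rwa [e] at hxy)⟩

/-- A chain for the pulled-back jump function maps pointwise to a chain with the same times. Jump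
sizes are evaluated at the point where the jump starts, which is where `exists_jump_pullback`
compares them. -/
theorem IsStronglyChainTransitive.image {d : X → X → ℝ} {d' : Y → Y → ℝ}
    (hd : IsCompatibleMetric d) (hd' : IsCompatibleMetric d') (h : X ≃ₜ Y)
    {φ : ℝ → X → X} {ψ : ℝ → Y → Y} (hconj : ∀ t x, h (φ t x) = ψ t (h x)) {A : Set X}
    (hA : IsStronglyChainTransitive d φ A) : IsStronglyChainTransitive d' ψ (h '' A) := by
  rintro _ ⟨x, hx, rfl⟩ _ ⟨y, hy, rfl⟩ T hT ε hε hpos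
  obtain ⟨δ, hδ, hδpos, hdom⟩ := exists_jump_pullback hd hd' h hε hpos
  obtain ⟨k, c, τ, hk, h0, h1, hc⟩ := hA x hx y hy T hT δ hδ hδpos
  refine ⟨k, h ∘ c, τ, hk, congrArg h h0, congrArg h h1, fun j hj => ⟨(hc j hj).1, ?_⟩⟩
  have := hdom _ _ (hc j hj).2
  rwa [hconj] at this

theorem IsStronglyChainControllable.map {U : Type*} {d : X → X → ℝ} {d' : Y → Y → ℝ}
    (hd : IsCompatibleMetric d) (hd' : IsCompatibleMetric d') (h : X ≃ₜ Y)
    {φ : ℝ → X → U → X} {ψ : ℝ → Y → U → Y} (hconj : ∀ t x u, h (φ t x u) = ψ t (h x) u)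
    {x y : X} (hxy : IsStronglyChainControllable d φ x y) :
    IsStronglyChainControllable d' ψ (h x) (h y) := by
  intro T hT ε hε hpos
  obtain ⟨δ, hδ, hδpos, hdom⟩ := exists_jump_pullback hd hd' h hε hpos
  obtain ⟨k, c, u, τ, hk, h0, h1, hc⟩ := hxy T hT δ hδ hδpos
  refine ⟨k, h ∘ c, u, τ, hk, congrArg h h0, congrArg h h1, fun j hj => ⟨(hc j hj).1, ?_⟩⟩
  have := hdom _ _ (hc j hj).2
  rwa [hconj] at this

/-- Direct image under a bijection is an order isomorphism of power sets; the two hypotheses say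
that it matches `P` with `Q`, so it matches their maximal elements. -/
theorem setOf_maximal_eq_image {X Y : Type*} (h : X ≃ Y) {P : Set X → Prop} {Q : Set Y → Prop}
    (hPQ : ∀ A, P A → Q (h '' A)) (hQP : ∀ B, Q B → P (h.symm '' B)) :
    {D | Maximal Q D} = (fun C => h '' C) '' {C | Maximal P C} := by
  ext D
  constructor
  · rintro ⟨hD, hmax⟩
    refine ⟨h.symm '' D, ⟨hQP D hD, fun C hC hle => ?_⟩, h.image_symm_image D⟩
    have hDC : D ⊆ h '' C := by
      rw [← h.image_symm_image D]
      exact image_mono hle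
    rw [← h.symm_image_image C]
    exact image_mono (hmax (hPQ C hC) hDC)
  · rintro ⟨C, ⟨hC, hmax⟩, rfl⟩
    refine ⟨hPQ C hC, fun D hD hle => ?_⟩
    have hCD : C ⊆ h.symm '' D := by
      rw [← h.symm_image_image C]
      exact image_mono hle
    rw [← h.image_symm_image D]
    exact image_mono (hmax (hQP D hD) hCD)

/-- Topological conjugations preserve maximal invariant strongly chain transitive sets. -/
theorem setOf_isMaximalInvariantSCT_eq_image {d : X → X → ℝ} {d' : Y → Y → ℝ}
    (hd : IsCompatibleMetric d) (hd' : IsCompatibleMetric d')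
    {φ : ℝ → X → X} {ψ : ℝ → Y → Y} {h : X → Y} (hconj : IsTopologicalConjugation φ ψ h) :
    {D | IsMaximalInvariantSCT d' ψ D} = (fun C => h '' C) '' {C | IsMaximalInvariantSCT d φ C} := by
  obtain ⟨hh, hc⟩ := hconj
  let e : X ≃ₜ Y := hh.homeomorph
  have he : ∀ t x, e (φ t x) = ψ t (e x) := hc
  -- The inverse is a conjugacy too, so the transfer lemmas apply in both directions.
  have hs : ∀ t y, e.symm (ψ t y) = φ t (e.symm y) := fun t y => by
    rw [e.symm_apply_eq, he, e.apply_symm_apply]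
  refine setOf_maximal_eq_image e.toEquiv ?_ ?_
  · rintro A ⟨hne, hinv, hA⟩
    refine ⟨hne.image _, ?_, hA.image hd hd' e he⟩
    rintro t _ ⟨x, hx, rfl⟩
    exact ⟨φ t x, hinv t x hx, he t x⟩
  · rintro B ⟨hne, hinv, hB⟩
    refine ⟨hne.image _, ?_, hB.image hd' hd e.symm hs⟩
    rintro t _ ⟨y, hy, rfl⟩
    exact ⟨ψ t y, hinv t y hy, hs t y⟩

/-- Homeomorphisms that conjugate control systems preserve strong chain control sets. -/
theorem setOf_isStrongChainControlSet_eq_image {U : Type*} {d : X → X → ℝ} {d' : Y → Y → ℝ}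
    (hd : IsCompatibleMetric d) (hd' : IsCompatibleMetric d')
    {φ : ℝ → X → U → X} {ψ : ℝ → Y → U → Y} {h : X → Y} (hh : IsHomeomorph h)
    (hconj : ∀ t x u, h (φ t x u) = ψ t (h x) u) :
    {F | IsStrongChainControlSet d' ψ F} =
      (fun G => h '' G) '' {G | IsStrongChainControlSet d φ G} := by
  let e : X ≃ₜ Y := hh.homeomorph
  have he : ∀ t x u, e (φ t x u) = ψ t (e x) u := hconj
  have hs : ∀ t y u, e.symm (ψ t y u) = φ t (e.symm y) u := fun t y u => by
    rw [e.symm_apply_eq, he, e.apply_symm_apply]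
  refine setOf_maximal_eq_image e.toEquiv ?_ ?_
  · rintro A ⟨hne, hA, hinv⟩
    refine ⟨hne.image _, ?_, ?_⟩
    · rintro _ ⟨x, hx, rfl⟩ _ ⟨y, hy, rfl⟩
      exact (hA x hx y hy).map hd hd' e he
    · rintro _ ⟨x, hx, rfl⟩
      obtain ⟨u, hu⟩ := hinv x hx
      exact ⟨u, fun t => ⟨φ t x u, hu t, he t x u⟩⟩
  · rintro B ⟨hne, hB, hinv⟩
    refine ⟨hne.image _, ?_, ?_⟩
    · rintro _ ⟨x, hx, rfl⟩ _ ⟨y, hy, rfl⟩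
      exact (hB x hx y hy).map hd' hd e.symm hs
    · rintro _ ⟨x, hx, rfl⟩
      obtain ⟨u, hu⟩ := hinv x hx
      exact ⟨u, fun t => ⟨ψ t x u, hu t, hs t x u⟩⟩

end Transfer

end StrongChain

/-! ### The affine chart of projective space -/

namespace AffineControl

section Chart

variable {m : ℕ} {Ω : Set (EuclideanSpace ℝ (Fin m))}
  {E : Type*} [NormedAddCommGroup E] [NormedSpace ℝ E]

/-- The scalar relating `v` to `(x, 1)` can only be the last coordinate of `v`. This gives the
inverse chart in homogeneous coordinates. -/
theorem mk_eq_mk_one_iff {v : E × ℝ} (hv : v ≠ 0) (x : E) :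
    Projectivization.mk ℝ v hv = Projectivization.mk ℝ (x, (1 : ℝ)) (by simp) ↔
      v.2 ≠ 0 ∧ v.2⁻¹ • v.1 = x := by
  rw [Projectivization.mk_eq_mk_iff']
  constructor
  · rintro ⟨c, rfl⟩
    have hc : c ≠ 0 := by
      rintro rfl
      simp at hv
    simp [hc]
  · rintro ⟨h0, rfl⟩
    exact ⟨v.2, by ext <;> simp [h0]⟩

/-- Openness is the main point. In the quotient topology, the image of an open `V` is open because
its cone `{z ≠ 0, z⁻¹x ∈ V}` is open in the punctured space. -/
theorem isHomeomorph_projEmb : IsHomeomorph (projEmb : E → ProjAffine E) := by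
  have hcont : Continuous (projEmb : E → ProjAffine E) := by
    refine Continuous.subtype_mk ?_ _
    have h1 : Continuous fun x : E => (⟨(x, (1 : ℝ)), by simp⟩ : {v : E × ℝ // v ≠ 0}) := by
      fun_prop
    exact continuous_coinduced_rng.comp h1
  have hopen : IsOpenMap (projEmb : E → ProjAffine E) := by
    intro V hV
    let W : Set (ℙ ℝ (E × ℝ)) :=
      (fun x : E => Projectivization.mk ℝ (x, (1 : ℝ)) (by simp)) '' V
    have hW : IsOpen W := by
      refine isOpen_coinduced.2 ?_
      have hpre : Projectivization.mk' ℝ ⁻¹' W =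
          {v : {v : E × ℝ // v ≠ 0} | v.1.2 ≠ 0} ∩
            (fun v : {v : E × ℝ // v ≠ 0} => v.1.2⁻¹ • v.1.1) ⁻¹' V := by
        ext ⟨v, hv⟩
        constructor
        · rintro ⟨x, hx, hxv⟩
          obtain ⟨h0, h1⟩ := (mk_eq_mk_one_iff hv x).1 hxv.symm
          exact ⟨h0, by simpa only [mem_preimage, h1] using hx⟩
        · rintro ⟨h0, h1⟩
          exact ⟨_, h1, ((mk_eq_mk_one_iff hv _).2 ⟨h0, rfl⟩).symm⟩
      rw [hpre]
      -- Division by `z` is continuous only where `z ≠ 0`; that set being open, preimages within it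
      -- are open.
      refine ContinuousOn.isOpen_inter_preimage ?_ ?_ hV
      · exact ContinuousOn.smul (ContinuousOn.inv₀ (by fun_prop) fun v hv => hv) (by fun_prop)
      · exact isOpen_ne_fun (by fun_prop) continuous_const
    refine ⟨W, hW, ?_⟩
    ext p
    constructor
    · rintro ⟨x, hx, hxp⟩
      exact ⟨x, hx, Subtype.ext hxp⟩
    · rintro ⟨x, hx, rfl⟩
      exact ⟨x, hx, rfl⟩
  refine ⟨hcont, hopen, fun x y hxy => ?_, ?_⟩
  · have := ((mk_eq_mk_one_iff _ y).1 (congrArg Subtype.val hxy)).2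
    simpa using this
  · rintro ⟨_, x, rfl⟩
    exact ⟨x, rfl⟩

/-- The extended bilinear system restricts to the affine system on the hyperplane `z = 1`. -/
theorem AffineSystem.lift_trajectory_one [CompleteSpace E] (S : AffineSystem m E) (t : ℝ) (x : E)
    (u : Control Ω) : S.lift.trajectory t (x, 1) u = (S.trajectory t x u, 1) := by
  have h := S.isSolution_trajectory u x
  have hs : S.lift.IsSolution u (x, 1) (fun t => (S.trajectory t x u, (1 : ℝ))) := by
    have hc : Continuous fun t => (S.trajectory t x u, (1 : ℝ)) :=
      h.continuous.prodMk continuous_const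
    refine ⟨hc, S.lift.intervalIntegrable_rhs u hc 0, fun t => ?_⟩
    -- At `z = 1` the lifted vector field is the affine one padded with `0`; the continuous linear
    -- `inl` then commutes with the integral.
    have hr : ∀ s, S.lift.rhs (u.toLp s) (S.trajectory s x u, (1 : ℝ)) =
        ContinuousLinearMap.inl ℝ E ℝ (S.rhs (u.toLp s) (S.trajectory s x u)) := fun s => by
      rw [lift_rhs]
      simp [rhs]
    simp_rw [hr]
    rw [ContinuousLinearMap.intervalIntegral_comp_comm _ (h.intervalIntegrable t)]
    ext
    · simpa using h.eq_integral t
    · simp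
  exact (congrFun hs.eq_trajectory t).symm

theorem AffineSystem.projEmb_trajectory [CompleteSpace E] (S : AffineSystem m E) (t : ℝ) (x : E)
    (u : Control Ω) :
    projEmb (S.trajectory t x u) = S.projTrajectoryAffine t (projEmb x) u := by
  refine Subtype.ext ?_
  simp only [projEmb, projTrajectoryAffine, projTrajectory, Projectivization.map_mk]
  congr 1
  exact (S.lift_trajectory_one t x u).symm

end Chart

end AffineControl

/-- Projective compactification of an affine control system: the affine control flow is
topologically conjugate, by `id × ℙh`, to the projective control flow on `𝒰 × ℙ^{n,1}`; maximal
invariant strongly chain transitive sets correspond, and so do strong chain control sets. All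
metrics are arbitrary metrics that are compatible with the respective topologies. -/
theorem mainTheorem7 {m n : ℕ}
    (Ω : Set (EuclideanSpace ℝ (Fin m)))
    (hΩ_convex : Convex ℝ Ω) (hΩ_compact : IsCompact Ω) (hΩ_nhds : Ω ∈ 𝓝 0)
    (A₀ : Matrix (Fin n) (Fin n) ℝ) (a₀ : EuclideanSpace ℝ (Fin n))
    (A : Fin m → Matrix (Fin n) (Fin n) ℝ) (a : Fin m → EuclideanSpace ℝ (Fin n))
    (dU : Control Ω → Control Ω → ℝ) (hdU : IsCompatibleMetric dU)
    (dM : EuclideanSpace ℝ (Fin n) → EuclideanSpace ℝ (Fin n) → ℝ) (hdM : IsCompatibleMetric dM)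
    (dP : ProjAffine (EuclideanSpace ℝ (Fin n)) → ProjAffine (EuclideanSpace ℝ (Fin n)) → ℝ)
    (hdP : IsCompatibleMetric dP) :
    -- (i) topological conjugacy of the control flows
    IsTopologicalConjugation
      (controlFlow (Ω := Ω) (ofMatrices A₀ a₀ A a).trajectory)
      (controlFlow (Ω := Ω) (ofMatrices A₀ a₀ A a).projTrajectoryAffine)
      (Prod.map id projEmb) ∧
    -- (ii) maximal invariant strongly chain transitive sets
    {D | IsMaximalInvariantSCT (maxMetric dU dP)
        (controlFlow (Ω := Ω) (ofMatrices A₀ a₀ A a).projTrajectoryAffine) D} =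
      (fun C => Prod.map id projEmb '' C) ''
        {C | IsMaximalInvariantSCT (maxMetric dU dM)
          (controlFlow (Ω := Ω) (ofMatrices A₀ a₀ A a).trajectory) C} ∧
    -- (iii) strong chain control sets
    {F | IsStrongChainControlSet (U := Control Ω) dP
        (ofMatrices A₀ a₀ A a).projTrajectoryAffine F} =
      (fun G => projEmb '' G) ''
        {G | IsStrongChainControlSet (U := Control Ω) dM
          (ofMatrices A₀ a₀ A a).trajectory G} := by
  have hconj := (ofMatrices A₀ a₀ A a).projEmb_trajectory (Ω := Ω)
  have hflow : IsTopologicalConjugation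
      (controlFlow (Ω := Ω) (ofMatrices A₀ a₀ A a).trajectory)
      (controlFlow (Ω := Ω) (ofMatrices A₀ a₀ A a).projTrajectoryAffine)
      (Prod.map id projEmb) :=
    ⟨IsHomeomorph.id.prodMap isHomeomorph_projEmb,
      -- Both flows shift the control identically, so only the state component needs the conjugacy.
      fun t p => Prod.ext rfl (hconj t p.2 p.1)⟩
  exact ⟨hflow, setOf_isMaximalInvariantSCT_eq_image (hdU.maxMetric hdM) (hdU.maxMetric hdP) hflow,
    setOf_isStrongChainControlSet_eq_image hdM hdP isHomeomorph_projEmb hconj⟩
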